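/- Let $n,d\ge 1$ be integers, let $\theta^-,\theta^+\in\mathbb R^d$, $\sigma>0$, $0<\tau<1$, and let $[n\tau]$ denote the integer part of $n\tau$. One observes independent random vectors $Y_i=\theta_i+\eta_i$, $1\le i\le n$, in $\mathbb R^d$, where $\theta_i=\theta^-$ if $i\le n\tau$, $\theta_i=\theta^+$ if $i>n\tau$, and the $\eta_i$ are i.i.d. $\mathcal N(0,\sigma^2 I_d)$. Put $\Delta=\|\theta^+-\theta^-\|$. For an integer $1\le T\le d$ let $\hat\tau(T)=\hat k(T)/n$, where $\hat k(T)$ is any minimizer over $k\in\{2,\dots,n-2\}$ of $$\sum_{i=1}^{k}\sum_{j=1}^{T}\Big(Y_{i,j}-\frac1k\sum_{l=1}^{k}Y_{l,j}\Big)^2+\sum_{i=k+1}^{n}\sum_{j=1}^{T}\Big(Y_{i,j}-\frac1{n-k}\sum_{l=k+1}^{n}Y_{l,j}\Big)^2 ,$$ and let $$\Psi_n(T,\Delta)=\frac{\sigma^2}{n\Delta^2}\Big(1\vee\frac{\sigma^2T}{n\Delta^2}\Big).$$ For $s>0$ and $L\in\mathbb R$ let $$\Theta(s,L)=\Big\{\theta\in\mathbb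 R^d:\ \sup_{K\in\mathbb N^*}K^{2s}\sum_{k\ge K}\theta_k^2\le L^2\Big\}.$$ **Theorem.** For every $\gamma>0$ and $0<\varepsilon<1/2$ there exist constants $\kappa=\kappa(\gamma,\varepsilon)>0$ and $c=c(\gamma,\varepsilon)>0$ such that the following holds for all $n,d,T,s,L,\sigma,\tau,\theta^\pm$ as above with $\varepsilon<\tau<1-\varepsilon$, $2\le[n\tau]\le n-2$ and $\theta^-,\theta^+\in\Theta(s,L)$. (i) If $\Delta^2\ge 2c\,\dfrac{\sigma^2\ln n}{n}\vee 8L^2T^{-2s}$, then $$P\Big(\Big|\hat\tau(T)-\frac{[n\tau]}n\Big|\ge\kappa\ln(n)\,\Psi_n(T,\Delta)\Big)\le n^{-\gamma}.$$ (ii) If $\Delta^2\ge 2c\,\dfrac{\sigma^2\ln n}{n}\vee 8L^2T^{-2s}\vee\dfrac{\sigma^2T}{n}$, then $$P\Big(\Big|\hat\tau(T)-\frac{[n\tau]}n\Big|\ge\kappa\,\frac{\sigma^2\ln n}{n\Delta^2}\Big)\le n^{-\gamma}.$$ In particular, when $n\tau$ is an integer, $[n\tau]/n=\tau$, and (i),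 (ii) bound the error $|\hat\tau(T)-\tau|$. -/

import Mathlib

open MeasureTheory ProbabilityTheory

noncomputable section

namespace ChangePoint

/-- The class `Θ(s, L)` of vectors of `ℝ^d`: `K^{2s} ∑_{k ≥ K} θ_k² ≤ L²` for all `K ≥ 1`.
Coordinates are numbered `1, …, d`, so `j : Fin d` is the coordinate of number `j + 1`. -/
def sobolevClass (d : ℕ) (s L : ℝ) : Set (EuclideanSpace ℝ (Fin d)) :=
  {θ | ∀ K : ℕ, 1 ≤ K →
    (K : ℝ) ^ (2 * s) * ∑ j : Fin d with K ≤ j.val + 1, (θ j) ^ 2 ≤ L ^ 2}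

/-- The mean `θ_i` of the `i`-th signal: `θ⁻` if `i ≤ nτ` and `θ⁺` otherwise.
Signals are numbered `1, …, n`, so `i : Fin n` is the signal of number `i + 1`. -/
def signalMean {n d : ℕ} (τ : ℝ) (θm θp : EuclideanSpace ℝ (Fin d)) (i : Fin n) :
    EuclideanSpace ℝ (Fin d) :=
  if (i.val : ℝ) + 1 ≤ (n : ℝ) * τ then θm else θp

/-- The change-point model `Y_i = θ_i + η_i`, `1 ≤ i ≤ n`, where the noise vectors `η_i` are
i.i.d. with law `N(0, σ² I_d)`. -/
structure IsModel {Ω : Type*} [MeasurableSpace Ω] (P : Measure Ω) {n d : ℕ} (σ τ : ℝ)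
    (θm θp : EuclideanSpace ℝ (Fin d)) (Y : Fin n → Ω → EuclideanSpace ℝ (Fin d)) : Prop where
  /-- the noise vectors are independent -/
  indep : iIndepFun (fun (i : Fin n) (ω : Ω) => Y i ω - signalMean τ θm θp i) P
  /-- each noise vector has law `N(0, σ² I_d)` -/
  law : ∀ i : Fin n, HasLaw (fun ω : Ω => Y i ω - signalMean τ θm θp i)
    (multivariateGaussian 0 ((σ ^ 2) • (1 : Matrix (Fin d) (Fin d) ℝ))) P

/-- The least-squares criterion of a split of the signals `y` after the `k`-th one, computed on
their first `T` coordinates. -/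
def criterion {n d : ℕ} (T : ℕ) (y : Fin n → EuclideanSpace ℝ (Fin d)) (k : ℕ) : ℝ :=
  (∑ i : Fin n with i.val < k, ∑ j : Fin d with j.val < T,
      (y i j - (1 / (k : ℝ)) * ∑ i' : Fin n with i'.val < k, y i' j) ^ 2) +
    ∑ i : Fin n with k ≤ i.val, ∑ j : Fin d with j.val < T,
      (y i j - (1 / ((n : ℝ) - (k : ℝ))) * ∑ i' : Fin n with k ≤ i'.val, y i' j) ^ 2

/-- `kHat` selects, for every outcome, a minimizer of the criterion over `{2, …, n - 2}`. -/
def IsEstimator {Ω : Type*} {n d : ℕ} (T : ℕ) (Y : Fin n → Ω → EuclideanSpace ℝ (Fin d))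
    (kHat : Ω → ℕ) : Prop :=
  ∀ ω : Ω, kHat ω ∈ Finset.Icc 2 (n - 2) ∧
    ∀ k ∈ Finset.Icc 2 (n - 2),
      criterion T (fun i => Y i ω) (kHat ω) ≤ criterion T (fun i => Y i ω) k

/-- The rate `Ψ_n(T, Δ) = σ²/(nΔ²) · (1 ∨ σ²T/(nΔ²))`. -/
def rate (σ : ℝ) (n T : ℕ) (Δ : ℝ) : ℝ :=
  σ ^ 2 / ((n : ℝ) * Δ ^ 2) * max 1 (σ ^ 2 * (T : ℝ) / ((n : ℝ) * Δ ^ 2))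

end ChangePoint

end

/-!
For a split `k`, let `a_k ∈ ℝ^T` be the normalized CUSUM statistic
`√(n / (k (n - k))) (∑_{i ≤ k} Y_i - (k / n) ∑_i Y_i)`. The least-squares criterion at `k` is a
quantity free of `k` minus `‖a_k‖²` (`criterion_eq`), so if `k` is selected instead of the true split
`m = [nτ]`, then `0 ≤ ‖a_k‖² - ‖a_m‖² = ⟪a_k - a_m, a_k + a_m⟫`.

The coordinates of `a_k` and `a_m` are Gaussian with the same variance `σ²`, with correlation `ρ`, and
the mean of `a_k` is `ρ` times that of `a_m` (`sum_splitWeight_mul_signalMean`). Hence `a_k - a_m` and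
`a_k + a_m` are independent, and the exponential moment of their inner product is explicit: a Gaussian
integral in one factor, then the integral of the exponential of a quadratic polynomial in the other
(`mgf_mul_of_indepFun`). At the exponent `δ / σ²` with `δ ≤ 1/4` it is at most
`exp (r δ (4 T δ - M / (2 σ²)))`, where `r = 1 - ρ²` and `M` is the squared norm of the mean of `a_m`
(`measureReal_criterion_le_criterion`).

Three estimates conclude. The gap satisfies `r ≥ |k - m| / n`
(`abs_sub_div_le_one_sub_splitCorr_sq`). The drift satisfies `M ≥ ε² n Δ² / 3`, since the smoothness
class and `Δ² ≥ 8 L² T^{-2s}` leave half of `Δ²` in the first `T` coordinates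
(`half_norm_sq_le_sum`). With `δ` of order `ε² / max 1 (σ² T / (n Δ²))` the drift dominates, and the
exponent is at most `-(γ + 1) ln n` as soon as `|k - m| / n ≥ κ ln(n) Ψ_n(T, Δ)`
(`chernoff_exponent_le`). A union bound over fewer than `n` splits costs one factor `n`.
-/

namespace ChangePoint

/-! ### Exponential moments of products of Gaussian variables -/

/-- The exponential moment of a quadratic polynomial of a Gaussian variable. Completing the square
turns the integrand, against the density of `N(p, v)`, into a constant times the density of
`N((p + β v) / D, v / D)` with `D = 1 - 2 α v`. -/
lemma lintegral_exp_quadratic_gaussianReal {v : NNReal} (hv : v ≠ 0) (p α β : ℝ)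
    (h : 2 * α * v < 1) :
    ∫⁻ x, ENNReal.ofReal (Real.exp (α * x ^ 2 + β * x)) ∂(gaussianReal p v) =
      ENNReal.ofReal ((√(1 - 2 * α * v))⁻¹ *
        Real.exp ((α * p ^ 2 + β * p + β ^ 2 * v / 2) / (1 - 2 * α * v))) := by
  have hv0 : (0 : ℝ) < v := NNReal.coe_pos.2 (pos_iff_ne_zero.2 hv)
  set D : ℝ := 1 - 2 * α * v with hD
  have hD0 : 0 < D := by linarith
  set v' : NNReal := ⟨v / D, (div_pos hv0 hD0).le⟩ with hv'
  have hv'c : (v' : ℝ) = v / D := rfl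
  have hv'0 : v' ≠ 0 := by
    intro h0
    have h1 : (v' : ℝ) = 0 := by rw [h0]; rfl
    rw [hv'c] at h1
    exact (div_pos hv0 hD0).ne' h1
  have key : ∀ x, gaussianPDFReal p v x * Real.exp (α * x ^ 2 + β * x) =
      (√D)⁻¹ * Real.exp ((α * p ^ 2 + β * p + β ^ 2 * v / 2) / D) *
        gaussianPDFReal ((p + β * v) / D) v' x := by
    intro x
    have hs : √(2 * Real.pi * (v / D)) = √(2 * Real.pi * v) / √D := by
      rw [← Real.sqrt_div (by positivity)]; congr 1; ring
    have hsD : √D ≠ 0 := (Real.sqrt_pos.2 hD0).ne'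
    simp only [gaussianPDFReal, hv'c, hs]
    have hexp : -(x - p) ^ 2 / (2 * v) + (α * x ^ 2 + β * x) =
        (α * p ^ 2 + β * p + β ^ 2 * v / 2) / D +
          -(x - (p + β * v) / D) ^ 2 / (2 * (v / D)) := by
      have hα : α = (1 - D) / (2 * v) := by rw [hD]; field_simp; ring
      rw [hα]
      field_simp
      ring
    rw [mul_assoc, ← Real.exp_add, hexp, Real.exp_add, inv_div]
    field_simp
  rw [gaussianReal_of_var_ne_zero _ hv,
    lintegral_withDensity_eq_lintegral_mul _ (measurable_gaussianPDF _ _) (by fun_prop)]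
  have : ∀ x, (gaussianPDF p v * fun x ↦ ENNReal.ofReal (Real.exp (α * x ^ 2 + β * x))) x =
      ENNReal.ofReal ((√D)⁻¹ * Real.exp ((α * p ^ 2 + β * p + β ^ 2 * v / 2) / D)) *
        gaussianPDF ((p + β * v) / D) v' x := by
    intro x
    rw [Pi.mul_apply, gaussianPDF, gaussianPDF, ← ENNReal.ofReal_mul (gaussianPDFReal_nonneg _ _ _),
      key, ENNReal.ofReal_mul (by positivity)]
  simp_rw [this]
  rw [lintegral_const_mul _ (measurable_gaussianPDF _ _), lintegral_gaussianPDF_eq_one _ hv'0,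
    mul_one]

lemma lintegral_exp_mul_gaussianReal (q t : ℝ) (w : NNReal) :
    ∫⁻ y, ENNReal.ofReal (Real.exp (t * y)) ∂(gaussianReal q w) =
      ENNReal.ofReal (Real.exp (q * t + w * t ^ 2 / 2)) := by
  rw [← ofReal_integral_eq_lintegral_ofReal (integrable_exp_mul_gaussianReal t)
    (ae_of_all _ fun _ ↦ (Real.exp_pos _).le)]
  congr 1
  have := congrFun (mgf_id_gaussianReal (μ := q) (v := w)) t
  simpa [mgf] using this

/-- The exponential moment of a product of two independent Gaussian variables: integrating out `W`
first leaves the exponential of a quadratic polynomial of `U`. -/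
lemma lintegral_exp_mul_mul_of_indepFun {Ω : Type*} [MeasurableSpace Ω] {P : Measure Ω}
    [IsProbabilityMeasure P] {U W : Ω → ℝ} {p q l : ℝ} {u w : NNReal} (hUW : IndepFun U W P)
    (hU : HasLaw U (gaussianReal p u) P) (hW : HasLaw W (gaussianReal q w) P) (hu : u ≠ 0)
    (h : l ^ 2 * u * w < 1) :
    ∫⁻ ω, ENNReal.ofReal (Real.exp (l * (U ω * W ω))) ∂P =
      ENNReal.ofReal ((√(1 - l ^ 2 * u * w))⁻¹ *
        Real.exp ((l * p * q + l ^ 2 * (p ^ 2 * w + q ^ 2 * u) / 2) / (1 - l ^ 2 * u * w))) := by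
  have hprod : P.map (fun ω ↦ (U ω, W ω)) = (gaussianReal p u).prod (gaussianReal q w) := by
    rw [(indepFun_iff_map_prod_eq_prod_map_map hU.aemeasurable hW.aemeasurable).1 hUW,
      hU.map_eq, hW.map_eq]
  calc ∫⁻ ω, ENNReal.ofReal (Real.exp (l * (U ω * W ω))) ∂P
      = ∫⁻ z, ENNReal.ofReal (Real.exp (l * (z.1 * z.2))) ∂(P.map fun ω ↦ (U ω, W ω)) := by
        rw [lintegral_map' (by fun_prop) (hU.aemeasurable.prodMk hW.aemeasurable)]
    _ = ∫⁻ x, ∫⁻ y, ENNReal.ofReal (Real.exp ((l * x) * y)) ∂(gaussianReal q w)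
          ∂(gaussianReal p u) := by
        rw [hprod, lintegral_prod _ (by fun_prop)]
        simp_rw [mul_assoc]
    _ = ∫⁻ x, ENNReal.ofReal (Real.exp (l ^ 2 * w / 2 * x ^ 2 + l * q * x))
          ∂(gaussianReal p u) := by
        simp_rw [lintegral_exp_mul_gaussianReal]
        congr! 4 with x
        ring
    _ = _ := by
        have e : 2 * (l ^ 2 * w / 2) * (u : ℝ) = l ^ 2 * u * w := by ring
        rw [lintegral_exp_quadratic_gaussianReal hu _ _ _ (by rw [e]; exact h), e]
        congr 4
        ring

lemma inv_sqrt_one_sub_le_exp {x : ℝ} (h0 : 0 ≤ x) (h1 : x ≤ 1 / 2) :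
    (√(1 - x))⁻¹ ≤ Real.exp x := by
  have hx : Real.exp (-x) ≤ √(1 - x) := by
    apply Real.le_sqrt_of_sq_le
    rw [← Real.exp_nat_mul]
    have h2 := Real.add_one_le_exp (2 * x)
    have h3 : Real.exp (((2 : ℕ) : ℝ) * -x) * Real.exp (2 * x) = 1 := by
      rw [← Real.exp_add]; simp
    have h4 := Real.exp_pos (((2 : ℕ) : ℝ) * -x)
    have h5 : Real.exp (((2 : ℕ) : ℝ) * -x) * (2 * x + 1) ≤ 1 := by
      exact (mul_le_mul_of_nonneg_left h2 h4.le).trans_eq h3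
    have h6 : 1 ≤ (1 - x) * (2 * x + 1) := by nlinarith
    exact le_of_mul_le_mul_right (h5.trans h6) (by linarith)
  rw [← inv_inv (Real.exp x), ← Real.exp_neg]
  exact inv_anti₀ (Real.exp_pos _) hx

lemma mgf_mul_of_indepFun {Ω : Type*} [MeasurableSpace Ω] {P : Measure Ω}
    [IsProbabilityMeasure P] {U W : Ω → ℝ} {p q l : ℝ} {u w : NNReal} (hUW : IndepFun U W P)
    (hU : HasLaw U (gaussianReal p u) P) (hW : HasLaw W (gaussianReal q w) P) (hu : u ≠ 0)
    (h : l ^ 2 * u * w < 1) :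
    mgf (fun ω ↦ U ω * W ω) P l = (√(1 - l ^ 2 * u * w))⁻¹ *
      Real.exp ((l * p * q + l ^ 2 * (p ^ 2 * w + q ^ 2 * u) / 2) / (1 - l ^ 2 * u * w)) := by
  have hm : AEMeasurable (fun ω ↦ Real.exp (l * (U ω * W ω))) P :=
    Real.measurable_exp.comp_aemeasurable ((hU.aemeasurable.mul hW.aemeasurable).const_mul l)
  rw [mgf, integral_eq_lintegral_of_nonneg_ae (ae_of_all _ fun _ ↦ (Real.exp_pos _).le)
    hm.aestronglyMeasurable, lintegral_exp_mul_mul_of_indepFun hUW hU hW hu h,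
    ENNReal.toReal_ofReal (by positivity)]

/-! ### CUSUM weights and the least-squares criterion -/

/-- The weights for which `∑ i, splitWeight n k i * x i` is the normalized CUSUM statistic
`√(n / (k (n - k))) (∑_{i < k} x i - (k / n) ∑_i x i)` of the split after `k` observations. They
sum to `0` and have square sum `1`. -/
noncomputable def splitWeight (n k : ℕ) (i : Fin n) : ℝ :=
  √((n : ℝ) / (k * (n - k))) * ((if i.val < k then 1 else 0) - (k : ℝ) / n)

/-- The correlation of the CUSUM statistics of the splits `k` and `m`, that is the inner product of
their weight vectors, in closed form. -/
noncomputable def splitCorr (n k m : ℕ) : ℝ :=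
  √((n : ℝ) / (k * (n - k))) * √((n : ℝ) / (m * (n - m))) * (min (k : ℝ) m - k * m / n)

lemma sum_indicator_lt {n k : ℕ} (hk : k ≤ n) :
    ∑ i : Fin n, (if i.val < k then (1 : ℝ) else 0) = k := by
  rw [Finset.sum_boole, Fin.card_filter_val_lt, min_eq_right hk]

lemma sum_splitWeight_mul_indicator {n k m : ℕ} (hk : k ≤ n) (hm : m ≤ n) :
    ∑ i : Fin n, splitWeight n k i * (if i.val < m then 1 else 0) =
      √((n : ℝ) / (k * (n - k))) * (min (k : ℝ) m - k * m / n) := by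
  have h : ∀ i : Fin n, splitWeight n k i * (if i.val < m then 1 else 0) =
      √((n : ℝ) / (k * (n - k))) * ((if i.val < min k m then 1 else 0) -
        (k : ℝ) / n * (if i.val < m then 1 else 0)) := by
    intro i
    simp only [splitWeight, lt_min_iff]
    split_ifs <;> simp_all
  simp_rw [h]
  rw [← Finset.mul_sum, Finset.sum_sub_distrib, ← Finset.mul_sum, sum_indicator_lt hm,
    sum_indicator_lt ((min_le_left k m).trans hk), Nat.cast_min]
  ring

lemma sum_splitWeight {n k : ℕ} (hk0 : 0 < k) (hk : k ≤ n) :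
    ∑ i : Fin n, splitWeight n k i = 0 := by
  have h := sum_splitWeight_mul_indicator hk le_rfl
  have hn : (n : ℝ) ≠ 0 := by have : 0 < n := hk0.trans_le hk; positivity
  have hkn : (k : ℝ) ≤ n := by exact_mod_cast hk
  simpa [min_eq_left hkn, hn] using h

lemma sum_splitWeight_mul_splitWeight {n k m : ℕ} (hk0 : 0 < k) (hk : k ≤ n) (hm : m ≤ n) :
    ∑ i : Fin n, splitWeight n k i * splitWeight n m i = splitCorr n k m := by
  have h : ∀ i : Fin n, splitWeight n k i * splitWeight n m i =
      √((n : ℝ) / (m * (n - m))) * (splitWeight n k i * (if i.val < m then 1 else 0)) -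
      √((n : ℝ) / (m * (n - m))) * (m / n) * splitWeight n k i := by
    intro i
    conv_lhs => rw [splitWeight.eq_def n m]
    ring
  simp_rw [h]
  rw [Finset.sum_sub_distrib, ← Finset.mul_sum, ← Finset.mul_sum, sum_splitWeight hk0 hk,
    sum_splitWeight_mul_indicator hk hm, splitCorr]
  ring

lemma splitCorr_comm (n k m : ℕ) : splitCorr n k m = splitCorr n m k := by
  rw [splitCorr, splitCorr, min_comm]; ring

lemma splitCorr_self {n k : ℕ} (hk0 : 0 < k) (hk : k < n) : splitCorr n k k = 1 := by
  have h1 : (0 : ℝ) < k := by exact_mod_cast hk0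
  have h2 : (0 : ℝ) < n - k := by rw [sub_pos]; exact_mod_cast hk
  have hn : (0 : ℝ) < n := by linarith
  rw [splitCorr, Real.mul_self_sqrt (by positivity), min_self]
  field_simp

lemma splitCorr_sq_of_le {n k m : ℕ} (hk0 : 0 < k) (hkm : k ≤ m) (hm : m < n) :
    splitCorr n k m ^ 2 = k * (n - m) / (m * (n - k)) := by
  have h1 : (0 : ℝ) < k := by exact_mod_cast hk0
  have h2 : (k : ℝ) ≤ m := by exact_mod_cast hkm
  have h3 : (0 : ℝ) < n - m := by rw [sub_pos]; exact_mod_cast hm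
  have h4 : (0 : ℝ) < n - k := by linarith
  have h5 : (0 : ℝ) < m := by linarith
  have hn : (0 : ℝ) < n := by linarith
  rw [splitCorr, mul_pow, mul_pow, Real.sq_sqrt (by positivity), Real.sq_sqrt (by positivity),
    min_eq_left h2]
  field_simp

/-- The gap `1 - ρ²`, which scales both the drift and the noise of the difference of two criteria, is
at least the relative distance of the two splits. -/
lemma abs_sub_div_le_one_sub_splitCorr_sq {n k m : ℕ} (hk0 : 0 < k) (hk : k < n) (hm0 : 0 < m)
    (hm : m < n) : |(k : ℝ) - m| / n ≤ 1 - splitCorr n k m ^ 2 := by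
  wlog hkm : k ≤ m generalizing k m
  · rw [abs_sub_comm, splitCorr_comm]
    exact this hm0 hm hk0 hk (le_of_not_ge hkm)
  have h1 : (0 : ℝ) < k := by exact_mod_cast hk0
  have h2 : (k : ℝ) ≤ m := by exact_mod_cast hkm
  have h3 : (0 : ℝ) < n - m := by rw [sub_pos]; exact_mod_cast hm
  have h4 : (0 : ℝ) < n - k := by linarith
  have h5 : (0 : ℝ) < m := by linarith
  have hn : (0 : ℝ) < n := by linarith
  have e : (1 : ℝ) - k * (n - m) / (m * (n - k)) = (m - k) * (n / (m * (n - k))) := by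
    field_simp; ring
  rw [splitCorr_sq_of_le hk0 hkm hm, abs_sub_comm, abs_of_nonneg (by linarith), e, div_eq_mul_inv]
  refine mul_le_mul_of_nonneg_left ?_ (by linarith)
  rw [inv_eq_one_div, div_le_div_iff₀ hn (by positivity)]
  nlinarith

lemma sum_sq_sub_average {ι : Type*} (s : Finset ι) (x : ι → ℝ) (c : ℝ) (hc : c = s.card)
    (hc0 : c ≠ 0) :
    ∑ i ∈ s, (x i - 1 / c * ∑ i' ∈ s, x i') ^ 2 = ∑ i ∈ s, x i ^ 2 - (∑ i ∈ s, x i) ^ 2 / c := by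
  simp_rw [sub_sq]
  rw [Finset.sum_add_distrib, Finset.sum_sub_distrib, Finset.sum_const, nsmul_eq_mul, ← hc,
    ← Finset.sum_mul, ← Finset.mul_sum]
  field_simp
  ring

/-- The analysis of variance behind least squares: the residual sum of squares of a split is the
total sum of squares less the squared CUSUM statistic. -/
lemma sum_sq_sub_average_split {n k : ℕ} (hk0 : 0 < k) (hk : k < n) (x : Fin n → ℝ) :
    (∑ i : Fin n with i.val < k, (x i - (1 / (k : ℝ)) * ∑ i' : Fin n with i'.val < k, x i') ^ 2) +
      ∑ i : Fin n with k ≤ i.val,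
        (x i - (1 / ((n : ℝ) - (k : ℝ))) * ∑ i' : Fin n with k ≤ i'.val, x i') ^ 2 =
      ∑ i, x i ^ 2 - (∑ i, x i) ^ 2 / n - (∑ i, splitWeight n k i * x i) ^ 2 := by
  have h1 : (0 : ℝ) < k := by exact_mod_cast hk0
  have h4 : (0 : ℝ) < n - k := by rw [sub_pos]; exact_mod_cast hk
  have hn : (0 : ℝ) < n := by linarith
  have hsplit : ∀ f : Fin n → ℝ, ∑ i, f i =
      ∑ i : Fin n with i.val < k, f i + ∑ i : Fin n with k ≤ i.val, f i := by
    intro f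
    rw [← Finset.sum_filter_add_sum_filter_not Finset.univ (fun i : Fin n ↦ i.val < k)]
    simp only [not_lt]
  have hc1 : ((Finset.univ.filter fun i : Fin n ↦ i.val < k).card : ℝ) = k := by
    rw [Fin.card_filter_val_lt, min_eq_right hk.le]
  have hc2 : ((Finset.univ.filter fun i : Fin n ↦ k ≤ i.val).card : ℝ) = n - k := by
    have := hsplit fun _ ↦ 1
    simp only [Finset.sum_const, nsmul_eq_mul, mul_one, hc1, Finset.card_univ, Fintype.card_fin]
      at this
    linarith
  have hw : ∑ i, splitWeight n k i * x i = √((n : ℝ) / (k * (n - k))) *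
      (∑ i : Fin n with i.val < k, x i - (k : ℝ) / n * ∑ i, x i) := by
    simp_rw [splitWeight, mul_assoc, sub_mul]
    rw [← Finset.mul_sum, Finset.sum_sub_distrib, ← Finset.mul_sum, Finset.sum_filter]
    simp
  rw [sum_sq_sub_average _ x _ hc1.symm h1.ne', sum_sq_sub_average _ x _ hc2.symm h4.ne', hw,
    mul_pow, Real.sq_sqrt (by positivity), hsplit x, hsplit fun i ↦ x i ^ 2]
  field_simp
  ring

/-- The criterion depends on `k` only through the squared norm of the CUSUM statistic, so minimizing
the criterion is maximizing that norm. -/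
lemma criterion_eq {n d : ℕ} (T : ℕ) (y : Fin n → EuclideanSpace ℝ (Fin d)) {k : ℕ} (hk0 : 0 < k)
    (hk : k < n) :
    criterion T y k = ∑ j : Fin d with j.val < T, (∑ i, y i j ^ 2 - (∑ i, y i j) ^ 2 / n) -
      ∑ j : Fin d with j.val < T, (∑ i, splitWeight n k i * y i j) ^ 2 := by
  rw [criterion, Finset.sum_comm, Finset.sum_comm (s := Finset.univ.filter _)
    (t := Finset.univ.filter fun j : Fin d ↦ j.val < T), ← Finset.sum_add_distrib,
    ← Finset.sum_sub_distrib]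
  exact Finset.sum_congr rfl fun j _ ↦ sum_sq_sub_average_split hk0 hk fun i ↦ y i j

/-! ### Linear combinations of the noise -/

section Noise
variable {Ω : Type*} [MeasurableSpace Ω] {P : Measure Ω} {n d : ℕ} {σ : ℝ}
  {η : Fin n → Ω → EuclideanSpace ℝ (Fin d)}

lemma posSemidef_sq_smul_one (d : ℕ) (σ : ℝ) :
    ((σ ^ 2) • (1 : Matrix (Fin d) (Fin d) ℝ)).PosSemidef :=
  Matrix.PosSemidef.one.smul (sq_nonneg σ)

lemma covariance_noise [IsProbabilityMeasure P] (hind : iIndepFun η P)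
    (hlaw : ∀ i, HasLaw (η i) (multivariateGaussian 0 ((σ ^ 2) • (1 : Matrix (Fin d) (Fin d) ℝ))) P)
    (i i' : Fin n) (j j' : Fin d) :
    cov[fun ω ↦ η i ω j, fun ω ↦ η i' ω j'; P] = if i = i' ∧ j = j' then σ ^ 2 else 0 := by
  have hmem : ∀ i j, MemLp (fun ω ↦ η i ω j) 2 P := fun i j ↦
    ((hlaw i).hasGaussianLaw.map_fun (EuclideanSpace.proj j)).memLp_two
  by_cases hi : i = i'
  · subst hi
    have h := covariance_eval_multivariateGaussian (μ := 0) (posSemidef_sq_smul_one d σ) j j'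
    rw [← (hlaw i).map_eq, covariance_map_fun (by fun_prop) (by fun_prop) (hlaw i).aemeasurable] at h
    rw [h]
    simp [Matrix.one_apply]
  · simp only [hi, false_and, if_false]
    have h : IndepFun (fun ω ↦ η i ω j) (fun ω ↦ η i' ω j') P :=
      (hind.indepFun hi).comp (φ := fun x : EuclideanSpace ℝ (Fin d) ↦ x j)
        (ψ := fun x : EuclideanSpace ℝ (Fin d) ↦ x j') (by fun_prop) (by fun_prop)
    exact h.covariance_eq_zero (hmem _ _) (hmem _ _)

lemma covariance_sum_noise [IsProbabilityMeasure P] (hind : iIndepFun η P)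
    (hlaw : ∀ i, HasLaw (η i) (multivariateGaussian 0 ((σ ^ 2) • (1 : Matrix (Fin d) (Fin d) ℝ))) P)
    (a b : Fin n → ℝ) (j j' : Fin d) :
    cov[fun ω ↦ ∑ i, a i * η i ω j, fun ω ↦ ∑ i, b i * η i ω j'; P] =
      if j = j' then σ ^ 2 * ∑ i, a i * b i else 0 := by
  have hmem : ∀ i j, MemLp (fun ω ↦ η i ω j) 2 P := fun i j ↦
    ((hlaw i).hasGaussianLaw.map_fun (EuclideanSpace.proj j)).memLp_two
  rw [covariance_fun_sum_fun_sum (fun i ↦ (hmem i j).const_mul _) (fun i ↦ (hmem i j').const_mul _)]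
  simp_rw [covariance_const_mul_left, covariance_const_mul_right, covariance_noise hind hlaw]
  by_cases hj : j = j'
  · simp only [hj, and_true, if_true, mul_ite, mul_zero, Finset.sum_ite_eq, Finset.mem_univ,
      Finset.mul_sum]
    exact Finset.sum_congr rfl fun i _ ↦ by ring
  · simp [hj]

lemma hasGaussianLaw_sum_noise {κ : Type*} [Fintype κ] (hind : iIndepFun η P)
    (hlaw : ∀ i, HasLaw (η i) (multivariateGaussian 0 ((σ ^ 2) • (1 : Matrix (Fin d) (Fin d) ℝ))) P)
    (c : κ → Fin n → ℝ) :
    HasGaussianLaw (fun ω (j : Fin d) (l : κ) ↦ ∑ i, c l i * η i ω j) P := by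
  have h := hind.hasGaussianLaw fun i ↦ (hlaw i).hasGaussianLaw
  let L : (Fin n → EuclideanSpace ℝ (Fin d)) →L[ℝ] (Fin d → κ → ℝ) :=
    ContinuousLinearMap.pi fun j ↦ ContinuousLinearMap.pi fun l ↦
      ∑ i, c l i • (EuclideanSpace.proj j).comp (ContinuousLinearMap.proj i)
  have e : (fun ω (j : Fin d) (l : κ) ↦ ∑ i, c l i * η i ω j) = fun ω ↦ L fun i ↦ η i ω := by
    ext ω j l
    simp [L]
  rw [e]
  exact h.map_fun L

lemma iIndepFun_sum_noise [IsProbabilityMeasure P] {κ : Type*} [Fintype κ] (hind : iIndepFun η P)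
    (hlaw : ∀ i, HasLaw (η i) (multivariateGaussian 0 ((σ ^ 2) • (1 : Matrix (Fin d) (Fin d) ℝ))) P)
    (c : κ → Fin n → ℝ) :
    iIndepFun (fun (j : Fin d) ω (l : κ) ↦ ∑ i, c l i * η i ω j) P :=
  (hasGaussianLaw_sum_noise hind hlaw c).iIndepFun_of_covariance_eval
    (X := fun j l ω ↦ ∑ i, c l i * η i ω j) fun j j' hj l l' ↦ by
      rw [covariance_sum_noise hind hlaw, if_neg hj]

lemma indepFun_sum_noise [IsProbabilityMeasure P] (hind : iIndepFun η P)
    (hlaw : ∀ i, HasLaw (η i) (multivariateGaussian 0 ((σ ^ 2) • (1 : Matrix (Fin d) (Fin d) ℝ))) P)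
    {a b : Fin n → ℝ} (hab : ∑ i, a i * b i = 0) (j : Fin d) :
    IndepFun (fun ω ↦ ∑ i, a i * η i ω j) (fun ω ↦ ∑ i, b i * η i ω j) P := by
  refine HasGaussianLaw.indepFun_of_covariance_eq_zero ?_ ?_
  · exact ((hasGaussianLaw_sum_noise hind hlaw fun l : Bool ↦ if l then a else b).eval j).prodMk
      true false
  · rw [covariance_sum_noise hind hlaw, hab]; simp

lemma hasLaw_sum_noise [IsProbabilityMeasure P] (hind : iIndepFun η P)
    (hlaw : ∀ i, HasLaw (η i) (multivariateGaussian 0 ((σ ^ 2) • (1 : Matrix (Fin d) (Fin d) ℝ))) P)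
    (a : Fin n → ℝ) (j : Fin d) :
    HasLaw (fun ω ↦ ∑ i, a i * η i ω j) (gaussianReal 0 (σ ^ 2 * ∑ i, a i ^ 2).toNNReal) P := by
  have hg : HasGaussianLaw (fun ω ↦ ∑ i, a i * η i ω j) P :=
    ((hasGaussianLaw_sum_noise hind hlaw fun _ : Unit ↦ a).eval j).eval ()
  have hG : ∀ i, HasGaussianLaw (fun ω ↦ η i ω j) P := fun i ↦
    (hlaw i).hasGaussianLaw.map_fun (EuclideanSpace.proj j)
  refine ⟨hg.aemeasurable, ?_⟩
  have hmean : ∀ i, P[fun ω ↦ η i ω j] = 0 := by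
    intro i
    have h := (measurePreserving_eval_multivariateGaussian (μ := 0)
      (posSemidef_sq_smul_one d σ) (i := j)).fun_comp_hasLaw (hlaw i)
    rw [h.integral_eq]
    simp
  rw [hg.map_eq_gaussianReal]
  congr 1
  · rw [integral_finsetSum _ fun i _ ↦ (hG i).integrable.const_mul _]
    simp_rw [integral_const_mul, hmean]
    simp
  · rw [← covariance_self hg.aemeasurable, covariance_sum_noise hind hlaw, if_pos rfl]
    simp_rw [sq]

end Noise

/-! ### Comparison of two splits -/

/-- The bound on the exponential moment, at `δ / σ²`, of `(a - b)(a + b)` for two Gaussian variables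
`a`, `b` of variance `σ²`, correlation `ρ` and means `ρ μ`, `μ`. The left side is the exact value
given by `mgf_mul_of_indepFun` for `U = a - b`, `W = a + b`. -/
lemma mgf_coordinate_le {σ δ ρ μ : ℝ} (hσ : 0 < σ) (hδ0 : 0 < δ) (hδ : δ ≤ 1 / 4)
    (hρ : ρ ^ 2 ≤ 1) :
    (√(1 - (δ / σ ^ 2) ^ 2 * (σ ^ 2 * (2 - 2 * ρ)) * (σ ^ 2 * (2 + 2 * ρ))))⁻¹ *
      Real.exp ((δ / σ ^ 2 * (-(1 - ρ) * μ) * ((1 + ρ) * μ) + (δ / σ ^ 2) ^ 2 *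
        ((-(1 - ρ) * μ) ^ 2 * (σ ^ 2 * (2 + 2 * ρ)) + ((1 + ρ) * μ) ^ 2 * (σ ^ 2 * (2 - 2 * ρ))) / 2)
        / (1 - (δ / σ ^ 2) ^ 2 * (σ ^ 2 * (2 - 2 * ρ)) * (σ ^ 2 * (2 + 2 * ρ)))) ≤
    Real.exp (4 * δ ^ 2 * (1 - ρ ^ 2) - δ / 2 * (1 - ρ ^ 2) * μ ^ 2 / σ ^ 2) := by
  have hx : (δ / σ ^ 2) ^ 2 * (σ ^ 2 * (2 - 2 * ρ)) * (σ ^ 2 * (2 + 2 * ρ)) =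
      4 * δ ^ 2 * (1 - ρ ^ 2) := by
    field_simp; ring
  have hN : δ / σ ^ 2 * (-(1 - ρ) * μ) * ((1 + ρ) * μ) + (δ / σ ^ 2) ^ 2 *
        ((-(1 - ρ) * μ) ^ 2 * (σ ^ 2 * (2 + 2 * ρ)) + ((1 + ρ) * μ) ^ 2 * (σ ^ 2 * (2 - 2 * ρ))) / 2
      = -(δ * (1 - 2 * δ) * (1 - ρ ^ 2) * μ ^ 2 / σ ^ 2) := by
    field_simp; ring
  rw [hx, hN]
  have hr : 0 ≤ 1 - ρ ^ 2 := by linarith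
  have hr1 : 1 - ρ ^ 2 ≤ 1 := by linarith [sq_nonneg ρ]
  have hx0 : 0 ≤ 4 * δ ^ 2 * (1 - ρ ^ 2) := by positivity
  have hx1 : 4 * δ ^ 2 * (1 - ρ ^ 2) ≤ 1 / 2 := by nlinarith
  have hM : 0 ≤ (1 - ρ ^ 2) * μ ^ 2 / σ ^ 2 := by positivity
  have hN0 : δ / 2 * (1 - ρ ^ 2) * μ ^ 2 / σ ^ 2 ≤
      δ * (1 - 2 * δ) * (1 - ρ ^ 2) * μ ^ 2 / σ ^ 2 := by
    have h1 : δ / 2 ≤ δ * (1 - 2 * δ) := by nlinarith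
    have h2 := mul_le_mul_of_nonneg_right h1 hM
    calc _ = δ / 2 * ((1 - ρ ^ 2) * μ ^ 2 / σ ^ 2) := by ring
      _ ≤ _ := h2
      _ = _ := by ring
  have hN1 : 0 ≤ δ / 2 * (1 - ρ ^ 2) * μ ^ 2 / σ ^ 2 := by positivity
  rw [sub_eq_add_neg (4 * δ ^ 2 * (1 - ρ ^ 2)) (δ / 2 * (1 - ρ ^ 2) * μ ^ 2 / σ ^ 2), Real.exp_add]
  gcongr
  · exact inv_sqrt_one_sub_le_exp hx0 hx1
  · rw [div_le_iff₀ (by linarith)]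
    nlinarith

variable {Ω : Type*} [MeasurableSpace Ω] {P : Measure Ω} {n d : ℕ} {σ τ : ℝ}
  {θm θp : EuclideanSpace ℝ (Fin d)} {Y : Fin n → Ω → EuclideanSpace ℝ (Fin d)}

lemma signalMean_apply (hτ : 0 ≤ (n : ℝ) * τ) (i : Fin n) (j : Fin d) :
    signalMean τ θm θp i j =
      θp j - (θp j - θm j) * (if i.val < ⌊(n : ℝ) * τ⌋₊ then 1 else 0) := by
  have h : (i.val : ℝ) + 1 ≤ (n : ℝ) * τ ↔ i.val < ⌊(n : ℝ) * τ⌋₊ := by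
    rw [← Nat.succ_le_iff, Nat.le_floor_iff hτ]
    push_cast
    rfl
  simp only [signalMean, h]
  split_ifs <;> simp

/-- The mean of the CUSUM statistic of the split `k` is `splitCorr n k m` times that of the true split
`m`: the mean signal is, up to a constant vector, a multiple of the weight vector of `m`. -/
lemma sum_splitWeight_mul_signalMean (hτ : 0 ≤ (n : ℝ) * τ) {k m : ℕ} (hm : m = ⌊(n : ℝ) * τ⌋₊)
    (hk0 : 0 < k) (hk : k < n) (hm0 : 0 < m) (hmn : m < n) (j : Fin d) :
    ∑ i, splitWeight n k i * signalMean τ θm θp i j =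
      splitCorr n k m * (-√((m : ℝ) * (n - m) / n) * (θp j - θm j)) := by
  have h1 : (0 : ℝ) < m := by exact_mod_cast hm0
  have h2 : (0 : ℝ) < n - m := by rw [sub_pos]; exact_mod_cast hmn
  have hn : (0 : ℝ) < n := by linarith
  simp_rw [signalMean_apply hτ, ← hm, mul_sub]
  rw [Finset.sum_sub_distrib, ← Finset.sum_mul, sum_splitWeight hk0 hk.le]
  have h : ∀ i : Fin n, splitWeight n k i * ((θp j - θm j) * if i.val < m then 1 else 0) =
      (θp j - θm j) * (splitWeight n k i * if i.val < m then 1 else 0) := fun i ↦ by ring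
  have hs : √((n : ℝ) / (m * (n - m))) * √((m : ℝ) * (n - m) / n) = 1 := by
    rw [← Real.sqrt_mul (by positivity), div_mul_div_cancel₀ (by positivity), div_self hn.ne',
      Real.sqrt_one]
  simp_rw [← mul_sub, h]
  rw [← Finset.mul_sum, sum_splitWeight_mul_indicator hk.le hmn.le, splitCorr]
  linear_combination √((n : ℝ) / (k * (n - k))) * (min (k : ℝ) m - k * m / n) *
    (θp j - θm j) * hs

/-- Chernoff bound for the event that the split `k` fits at least as well as the true split `m`.
With `a`, `b` the CUSUM statistics of `k` and `m`, the event is `0 ≤ ∑_{j < T} (a_j - b_j)(a_j + b_j)`,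
where all the factors are independent Gaussian variables. -/
theorem measureReal_criterion_le_criterion [IsProbabilityMeasure P] (hσ : 0 < σ)
    (hτ : 0 ≤ (n : ℝ) * τ) (hY : IsModel P σ τ θm θp Y) {k m : ℕ} (hm : m = ⌊(n : ℝ) * τ⌋₊)
    (hk0 : 0 < k) (hk : k < n) (hm0 : 0 < m) (hmn : m < n) (hkm : k ≠ m) (T : ℕ) {δ : ℝ}
    (hδ0 : 0 < δ) (hδ : δ ≤ 1 / 4) :
    P.real {ω | criterion T (fun i ↦ Y i ω) k ≤ criterion T (fun i ↦ Y i ω) m} ≤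
      Real.exp ((1 - splitCorr n k m ^ 2) * δ * (4 * T * δ - (m : ℝ) * (n - m) / n *
        (∑ j : Fin d with j.val < T, (θp j - θm j) ^ 2) / (2 * σ ^ 2))) := by
  have h1 : (0 : ℝ) < m := by exact_mod_cast hm0
  have h2 : (0 : ℝ) < n - m := by rw [sub_pos]; exact_mod_cast hmn
  have hn : (0 : ℝ) < n := by linarith
  set ρ := splitCorr n k m with hρdef
  have hρ : 0 < 1 - ρ ^ 2 := by
    refine lt_of_lt_of_le (div_pos (abs_pos.2 (sub_ne_zero.2 ?_)) hn)
      (abs_sub_div_le_one_sub_splitCorr_sq hk0 hk hm0 hmn)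
    exact_mod_cast hkm
  have hρ1 : ρ < 1 := by nlinarith
  have hρ2 : -1 < ρ := by nlinarith
  set S := Finset.univ.filter fun j : Fin d ↦ j.val < T with hS
  set η : Fin n → Ω → EuclideanSpace ℝ (Fin d) := fun i ω ↦ Y i ω - signalMean τ θm θp i with hη
  set μ : Fin d → ℝ := fun j ↦ -√((m : ℝ) * (n - m) / n) * (θp j - θm j) with hμ
  set a : Fin n → ℝ := fun i ↦ splitWeight n k i - splitWeight n m i with ha
  set b : Fin n → ℝ := fun i ↦ splitWeight n k i + splitWeight n m i with hb
  have ekk := (sum_splitWeight_mul_splitWeight hk0 hk.le hk.le).trans (splitCorr_self hk0 hk)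
  have emm := (sum_splitWeight_mul_splitWeight hm0 hmn.le hmn.le).trans (splitCorr_self hm0 hmn)
  have ekm : ∑ i, splitWeight n k i * splitWeight n m i = ρ :=
    sum_splitWeight_mul_splitWeight hk0 hk.le hmn.le
  have haa : ∑ i, a i ^ 2 = 2 - 2 * ρ := by
    have : ∀ i, a i ^ 2 = splitWeight n k i * splitWeight n k i +
      splitWeight n m i * splitWeight n m i - 2 * (splitWeight n k i * splitWeight n m i) :=
      fun i ↦ by simp only [ha]; ring
    simp_rw [this, Finset.sum_sub_distrib, Finset.sum_add_distrib, ← Finset.mul_sum, ekk, emm, ekm]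
    ring
  have hbb : ∑ i, b i ^ 2 = 2 + 2 * ρ := by
    have : ∀ i, b i ^ 2 = splitWeight n k i * splitWeight n k i +
      splitWeight n m i * splitWeight n m i + 2 * (splitWeight n k i * splitWeight n m i) :=
      fun i ↦ by simp only [hb]; ring
    simp_rw [this, Finset.sum_add_distrib, ← Finset.mul_sum, ekk, emm, ekm]
    ring
  have hab : ∑ i, a i * b i = 0 := by
    have : ∀ i, a i * b i = splitWeight n k i * splitWeight n k i -
      splitWeight n m i * splitWeight n m i := fun i ↦ by simp only [ha, hb]; ring
    simp_rw [this, Finset.sum_sub_distrib, ekk, emm]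
    ring
  set U : Fin d → Ω → ℝ := fun j ω ↦ -(1 - ρ) * μ j + ∑ i, a i * η i ω j with hU
  set W : Fin d → Ω → ℝ := fun j ω ↦ (1 + ρ) * μ j + ∑ i, b i * η i ω j with hW
  set Z : Fin d → Ω → ℝ := fun j ω ↦ U j ω * W j ω with hZ
  have hYη : ∀ l, 0 < l → l < n → ∀ j ω, ∑ i, splitWeight n l i * Y i ω j =
      splitCorr n l m * μ j + ∑ i, splitWeight n l i * η i ω j := by
    intro l hl0 hl j ω
    rw [← sum_splitWeight_mul_signalMean hτ hm hl0 hl hm0 hmn j, ← Finset.sum_add_distrib]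
    refine Finset.sum_congr rfl fun i _ ↦ ?_
    simp only [hη, PiLp.sub_apply]
    ring
  have hUY : ∀ j ω, U j ω =
      ∑ i, splitWeight n k i * Y i ω j - ∑ i, splitWeight n m i * Y i ω j := by
    intro j ω
    rw [hYη k hk0 hk, hYη m hm0 hmn, splitCorr_self hm0 hmn]
    simp only [hU, ha, sub_mul, Finset.sum_sub_distrib]
    ring
  have hWY : ∀ j ω, W j ω =
      ∑ i, splitWeight n k i * Y i ω j + ∑ i, splitWeight n m i * Y i ω j := by
    intro j ω
    rw [hYη k hk0 hk, hYη m hm0 hmn, splitCorr_self hm0 hmn]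
    simp only [hW, hb, add_mul, Finset.sum_add_distrib]
    ring
  have hset : {ω | criterion T (fun i ↦ Y i ω) k ≤ criterion T (fun i ↦ Y i ω) m} =
      {ω | 0 ≤ (∑ j ∈ S, Z j) ω} := by
    ext ω
    simp only [Set.mem_ofPred_eq, criterion_eq T _ hk0 hk, criterion_eq T _ hm0 hmn,
      Finset.sum_apply, hZ, hUY, hWY, sub_le_sub_iff_left]
    rw [← sub_nonneg, ← Finset.sum_sub_distrib]
    refine iff_of_eq (congrArg _ (Finset.sum_congr rfl fun j _ ↦ ?_))
    ring
  set u : NNReal := (σ ^ 2 * ∑ i, a i ^ 2).toNNReal with hu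
  set w : NNReal := (σ ^ 2 * ∑ i, b i ^ 2).toNNReal with hw
  have hu0 : 0 < σ ^ 2 * (2 - 2 * ρ) := mul_pos (by positivity) (by linarith)
  have hw0 : 0 < σ ^ 2 * (2 + 2 * ρ) := mul_pos (by positivity) (by linarith)
  have huc : (u : ℝ) = σ ^ 2 * (2 - 2 * ρ) := by
    rw [hu, haa, Real.coe_toNNReal _ hu0.le]
  have hwc : (w : ℝ) = σ ^ 2 * (2 + 2 * ρ) := by
    rw [hw, hbb, Real.coe_toNNReal _ hw0.le]
  have hUlaw : ∀ j, HasLaw (U j) (gaussianReal (-(1 - ρ) * μ j) u) P := fun j ↦ by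
    have h := gaussianReal_const_add (hasLaw_sum_noise hY.indep hY.law a j) (-(1 - ρ) * μ j)
    rwa [zero_add] at h
  have hWlaw : ∀ j, HasLaw (W j) (gaussianReal ((1 + ρ) * μ j) w) P := fun j ↦ by
    have h := gaussianReal_const_add (hasLaw_sum_noise hY.indep hY.law b j) ((1 + ρ) * μ j)
    rwa [zero_add] at h
  have hUW : ∀ j, IndepFun (U j) (W j) P := fun j ↦
    (indepFun_sum_noise hY.indep hY.law hab j).comp (φ := fun x ↦ -(1 - ρ) * μ j + x)
      (ψ := fun x ↦ (1 + ρ) * μ j + x) (by fun_prop) (by fun_prop)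
  have hZind : iIndepFun Z P := by
    have h := iIndepFun_sum_noise hY.indep hY.law fun l : Bool ↦ if l then a else b
    exact h.comp (fun j x ↦ (-(1 - ρ) * μ j + x true) * ((1 + ρ) * μ j + x false)) fun j ↦ by
      fun_prop
  have hlt : (δ / σ ^ 2) ^ 2 * u * w < 1 := by
    have hx : (δ / σ ^ 2) ^ 2 * u * w = 4 * δ ^ 2 * (1 - ρ ^ 2) := by
      rw [huc, hwc]; field_simp; ring
    rw [hx]
    nlinarith [sq_nonneg ρ]
  have hu_ne : u ≠ 0 := by
    intro h0
    rw [h0] at huc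
    exact hu0.ne huc
  -- Positivity of the `mgf` encodes integrability, which carries over to the product below.
  have hmgf : ∀ j, 0 < mgf (Z j) P (δ / σ ^ 2) ∧ mgf (Z j) P (δ / σ ^ 2) ≤
      Real.exp (4 * δ ^ 2 * (1 - ρ ^ 2) - δ / 2 * (1 - ρ ^ 2) * μ j ^ 2 / σ ^ 2) := by
    intro j
    rw [mgf_mul_of_indepFun (hUW j) (hUlaw j) (hWlaw j) hu_ne hlt]
    constructor
    · have := Real.sqrt_pos.2 (sub_pos.2 hlt)
      positivity
    · rw [huc, hwc]
      exact mgf_coordinate_le hσ hδ0 hδ (by linarith)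
  have hsum : mgf (∑ j ∈ S, Z j) P (δ / σ ^ 2) = ∏ j ∈ S, mgf (Z j) P (δ / σ ^ 2) :=
    hZind.mgf_sum₀ (fun j ↦ (hUlaw j).aemeasurable.mul (hWlaw j).aemeasurable) S
  have hint : Integrable (fun ω ↦ Real.exp (δ / σ ^ 2 * (∑ j ∈ S, Z j) ω)) P := by
    rw [← mgf_pos_iff, hsum]
    exact Finset.prod_pos fun j _ ↦ (hmgf j).1
  have hcard : (S.card : ℝ) ≤ T := by
    rw [hS, Fin.card_filter_val_lt]
    exact_mod_cast min_le_right _ _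
  rw [hset]
  refine (measure_ge_le_exp_mul_mgf 0 (by positivity) hint).trans ?_
  rw [mul_zero, Real.exp_zero, one_mul, hsum]
  refine (Finset.prod_le_prod (fun j _ ↦ (hmgf j).1.le) fun j _ ↦ (hmgf j).2).trans ?_
  rw [← Real.exp_sum, Real.exp_le_exp, Finset.sum_sub_distrib, Finset.sum_const, nsmul_eq_mul]
  have hμ2 : ∑ j ∈ S, δ / 2 * (1 - ρ ^ 2) * μ j ^ 2 / σ ^ 2 =
      δ / 2 * (1 - ρ ^ 2) * ((m : ℝ) * (n - m) / n * ∑ j ∈ S, (θp j - θm j) ^ 2) / σ ^ 2 := by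
    simp only [hμ, mul_pow, neg_sq]
    rw [Real.sq_sqrt (by positivity), Finset.mul_sum, Finset.mul_sum, Finset.sum_div]
  rw [hμ2]
  have hx0 : 0 ≤ 4 * δ ^ 2 * (1 - ρ ^ 2) := by positivity
  have := mul_le_mul_of_nonneg_right hcard hx0
  calc _ ≤ (T : ℝ) * (4 * δ ^ 2 * (1 - ρ ^ 2)) - _ := sub_le_sub_right this _
    _ = _ := by field_simp

/-! ### Deviation bound for the estimator -/

/-- The coordinates beyond the first `T` carry at most `L² T^{-2s}`; this is the condition of the
class at `K = T`, whose sum also contains the `T`-th coordinate. -/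
lemma sum_sq_tail_le {s L : ℝ} {θ : EuclideanSpace ℝ (Fin d)} (hθ : θ ∈ sobolevClass d s L) {T : ℕ}
    (hT : 1 ≤ T) : ∑ j : Fin d with ¬ j.val < T, θ j ^ 2 ≤ L ^ 2 * (T : ℝ) ^ (-2 * s) := by
  have hT0 : (0 : ℝ) < T := by exact_mod_cast hT
  have h := hθ T hT
  rw [neg_mul, Real.rpow_neg hT0.le, ← div_eq_mul_inv, le_div_iff₀' (Real.rpow_pos_of_pos hT0 _)]
  refine le_trans (mul_le_mul_of_nonneg_left ?_ (Real.rpow_nonneg hT0.le _)) h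
  refine Finset.sum_le_sum_of_subset_of_nonneg ?_ fun _ _ _ ↦ sq_nonneg _
  intro j hj
  simp only [Finset.mem_filter, Finset.mem_univ, true_and] at hj ⊢
  omega

/-- Truncation to the first `T` coordinates keeps at least half of the squared jump. -/
lemma half_norm_sq_le_sum {s L : ℝ} (hm : θm ∈ sobolevClass d s L) (hp : θp ∈ sobolevClass d s L)
    {T : ℕ} (hT : 1 ≤ T) (h : 8 * L ^ 2 * (T : ℝ) ^ (-2 * s) ≤ ‖θp - θm‖ ^ 2) :
    ‖θp - θm‖ ^ 2 / 2 ≤ ∑ j : Fin d with j.val < T, (θp j - θm j) ^ 2 := by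
  have h1 : ‖θp - θm‖ ^ 2 = ∑ j : Fin d, (θp j - θm j) ^ 2 := by
    simp [EuclideanSpace.real_norm_sq_eq]
  rw [← Finset.sum_filter_add_sum_filter_not Finset.univ (fun j : Fin d ↦ j.val < T)] at h1
  have h2 : ∑ j : Fin d with ¬ j.val < T, (θp j - θm j) ^ 2 ≤
      2 * ∑ j : Fin d with ¬ j.val < T, θp j ^ 2 + 2 * ∑ j : Fin d with ¬ j.val < T, θm j ^ 2 := by
    rw [Finset.mul_sum, Finset.mul_sum, ← Finset.sum_add_distrib]
    refine Finset.sum_le_sum fun j _ ↦ ?_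
    nlinarith [sq_nonneg (θp j + θm j)]
  linarith [sum_sq_tail_le hm hT, sum_sq_tail_le hp hT]

/-- The arithmetic of the Chernoff exponent at `δ = ε² / (48 R)`, `R = max 1 (σ² T / (N Δ²))`. This `δ`
makes the noise term `4 T δ` at most half of the drift `M / (2 σ²)`, and `R` cancels against the
factor `R` of the rate in the lower bound for `r`. -/
lemma chernoff_exponent_le {ε γ σ Δ N T M r ℓ κ R δ : ℝ} (hε : 0 < ε)
    (hσ : 0 < σ) (hΔ : 0 < Δ) (hN : 0 < N) (hℓ : 0 ≤ ℓ) (hγ : 0 < γ)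
    (hκ : κ = 576 * (γ + 1) / ε ^ 4)
    (hR : R = max 1 (σ ^ 2 * T / (N * Δ ^ 2))) (hδ : δ = ε ^ 2 / 48 / R)
    (hM : ε ^ 2 * N * Δ ^ 2 / 3 ≤ M) (hr : κ * ℓ * (σ ^ 2 / (N * Δ ^ 2) * R) ≤ r) :
    r * δ * (4 * T * δ - M / (2 * σ ^ 2)) ≤ -(γ + 1) * ℓ := by
  have hR1 : 1 ≤ R := by rw [hR]; exact le_max_left _ _
  have hR2 : σ ^ 2 * T / (N * Δ ^ 2) ≤ R := by rw [hR]; exact le_max_right _ _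
  have hR0 : 0 < R := by linarith
  have hδ0 : 0 < δ := by rw [hδ]; positivity
  have hκ0 : 0 < κ := by rw [hκ]; positivity
  have hr0 : 0 ≤ r := le_trans (by positivity) hr
  have hδT : 16 * T * δ * σ ^ 2 ≤ M := by
    refine le_trans ?_ hM
    rw [div_le_iff₀ (by positivity)] at hR2
    rw [hδ]
    calc 16 * T * (ε ^ 2 / 48 / R) * σ ^ 2 = ε ^ 2 / 3 * (σ ^ 2 * T) / R := by ring
      _ ≤ ε ^ 2 / 3 * (R * (N * Δ ^ 2)) / R := by gcongr
      _ = ε ^ 2 * N * Δ ^ 2 / 3 := by field_simp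
  have hM0 : 0 ≤ M := le_trans (by positivity) hM
  have h1 : 4 * T * δ - M / (2 * σ ^ 2) ≤ -(M / (4 * σ ^ 2)) := by
    have : 4 * T * δ ≤ M / (4 * σ ^ 2) := by
      rw [le_div_iff₀ (by positivity)]; linarith
    have e : M / (2 * σ ^ 2) = M / (4 * σ ^ 2) + M / (4 * σ ^ 2) := by ring
    linarith
  have h2 : (γ + 1) * ℓ ≤ r * δ * (M / (4 * σ ^ 2)) := by
    calc (γ + 1) * ℓ = κ * ℓ * (σ ^ 2 / (N * Δ ^ 2) * R) * δ *
          ((ε ^ 2 * N * Δ ^ 2 / 3) / (4 * σ ^ 2)) := by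
          rw [hκ, hδ]; field_simp; ring
      _ ≤ _ := by gcongr
  have h3 := mul_le_mul_of_nonneg_left h1 (mul_nonneg hr0 hδ0.le)
  linarith

/-- The error bound at the rate `Ψ_n(T, Δ)`, by a union bound over the splits `k` at distance at
least `κ ln(n) Ψ_n(T, Δ)` from the true one. The estimator need not be measurable, because the
event is covered by events on the observations alone. -/
theorem measureReal_error_le [IsProbabilityMeasure P] {γ ε s L : ℝ} {T : ℕ} {kHat : Ω → ℕ}
    (hγ : 0 < γ) (hε : 0 < ε) (hε' : ε < 1 / 2)
    (hT : 1 ≤ T) (hσ : 0 < σ) (hτ : ε < τ) (hτ' : τ < 1 - ε) (hm2 : 2 ≤ ⌊(n : ℝ) * τ⌋₊)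
    (hmn2 : ⌊(n : ℝ) * τ⌋₊ + 2 ≤ n) (hm : θm ∈ sobolevClass d s L) (hp : θp ∈ sobolevClass d s L)
    (hY : IsModel P σ τ θm θp Y) (hk : IsEstimator T Y kHat) (hΔ : 0 < ‖θp - θm‖)
    (hL : 8 * L ^ 2 * (T : ℝ) ^ (-2 * s) ≤ ‖θp - θm‖ ^ 2) :
    P.real {ω | 576 * (γ + 1) / ε ^ 4 * Real.log n * rate σ n T ‖θp - θm‖
        ≤ |(kHat ω : ℝ) / n - (⌊(n : ℝ) * τ⌋₊ : ℝ) / n|} ≤ (n : ℝ) ^ (-γ) := by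
  obtain ⟨m, hmdef⟩ : ∃ m, m = ⌊(n : ℝ) * τ⌋₊ := ⟨_, rfl⟩
  rw [← hmdef] at hm2 hmn2 ⊢
  have hn4 : (4 : ℝ) ≤ n := by exact_mod_cast (by omega : 4 ≤ n)
  have hn0 : (0 : ℝ) < n := by linarith
  have hlog : 0 < Real.log n := Real.log_pos (by linarith)
  have hτn : 0 ≤ (n : ℝ) * τ := mul_nonneg hn0.le (by linarith)
  have hm2' : (2 : ℝ) ≤ m := by exact_mod_cast hm2
  have hm_lo : (n : ℝ) * τ < m + 1 := by rw [hmdef]; exact Nat.lt_floor_add_one _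
  have hm_hi : (m : ℝ) ≤ n * τ := by rw [hmdef]; exact Nat.floor_le hτn
  set Δ := ‖θp - θm‖ with hΔdef
  set κ := 576 * (γ + 1) / ε ^ 4 with hκ
  have hκ0 : 0 < κ := by positivity
  set t := κ * Real.log n * rate σ n T Δ with ht
  have ht0 : 0 < t := by
    rw [ht, rate]
    have : (0 : ℝ) < max 1 (σ ^ 2 * (T : ℝ) / ((n : ℝ) * Δ ^ 2)) :=
      lt_max_of_lt_left one_pos
    positivity
  set F := (Finset.Icc 2 (n - 2)).filter fun k : ℕ ↦ t ≤ |(k : ℝ) / n - (m : ℝ) / n| with hF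
  have hsub : {ω | t ≤ |(kHat ω : ℝ) / n - (m : ℝ) / n|} ⊆
      ⋃ k ∈ F, {ω | criterion T (fun i ↦ Y i ω) k ≤ criterion T (fun i ↦ Y i ω) m} := by
    intro ω hω
    refine Set.mem_biUnion (x := kHat ω) (Finset.mem_filter.2 ⟨(hk ω).1, hω⟩) ?_
    exact (hk ω).2 m (Finset.mem_Icc.2 (by omega))
  have hM : ε ^ 2 * n * Δ ^ 2 / 3 ≤
      (m : ℝ) * (n - m) / n * ∑ j : Fin d with j.val < T, (θp j - θm j) ^ 2 := by
    -- As `m ≥ 2`, rounding `n τ` down to `m` loses at most a third of it.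
    have h1 : 2 / 3 * ε * n ≤ m := by nlinarith
    have h2 : ε * n ≤ n - m := by nlinarith
    have h3 : 2 / 3 * ε ^ 2 * n ≤ (m : ℝ) * (n - m) / n := by
      rw [le_div_iff₀ hn0]
      calc _ = (2 / 3 * ε * n) * (ε * n) := by ring
        _ ≤ _ := by gcongr
    calc _ = 2 / 3 * ε ^ 2 * n * (Δ ^ 2 / 2) := by ring
      _ ≤ _ := mul_le_mul h3 (half_norm_sq_le_sum hm hp hT hL) (by positivity)
        (le_trans (by positivity) h3)
  have hk_bound : ∀ k ∈ F,
      P.real {ω | criterion T (fun i ↦ Y i ω) k ≤ criterion T (fun i ↦ Y i ω) m} ≤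
        Real.exp (-(γ + 1) * Real.log n) := by
    intro k hkF
    obtain ⟨hk1, hk2⟩ := Finset.mem_filter.1 hkF
    rw [Finset.mem_Icc] at hk1
    have hkm : k ≠ m := by
      rintro rfl
      rw [sub_self, abs_zero] at hk2
      linarith
    set R := max 1 (σ ^ 2 * (T : ℝ) / ((n : ℝ) * Δ ^ 2)) with hR
    have hR1 : 1 ≤ R := le_max_left _ _
    have hδ : ε ^ 2 / 48 / R ≤ 1 / 4 := by
      rw [div_le_iff₀ (by linarith)]
      nlinarith
    have hgap : t ≤ 1 - splitCorr n k m ^ 2 := by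
      refine hk2.trans (le_trans (le_of_eq ?_)
        (abs_sub_div_le_one_sub_splitCorr_sq (by omega) (by omega) (by omega) (by omega)))
      rw [← sub_div, abs_div, abs_of_pos hn0]
    refine (measureReal_criterion_le_criterion hσ hτn hY hmdef (by omega) (by omega) (by omega)
      (by omega) hkm T (by positivity) hδ).trans (Real.exp_le_exp.2 ?_)
    exact chernoff_exponent_le hε hσ hΔ hn0 hlog.le hγ hκ hR rfl hM hgap
  have hcard : (F.card : ℝ) ≤ n := by
    have h : F.card ≤ (Finset.Icc 2 (n - 2)).card := Finset.card_filter_le _ _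
    rw [Nat.card_Icc] at h
    exact_mod_cast (by omega : F.card ≤ n)
  calc P.real {ω | t ≤ |(kHat ω : ℝ) / n - (m : ℝ) / n|}
      ≤ P.real (⋃ k ∈ F, {ω | criterion T (fun i ↦ Y i ω) k ≤ criterion T (fun i ↦ Y i ω) m}) :=
        measureReal_mono hsub (measure_ne_top _ _)
    _ ≤ ∑ k ∈ F, P.real {ω | criterion T (fun i ↦ Y i ω) k ≤ criterion T (fun i ↦ Y i ω) m} :=
        measureReal_biUnion_finset_le _ _
    _ ≤ F.card • Real.exp (-(γ + 1) * Real.log n) := Finset.sum_le_card_nsmul _ _ _ hk_bound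
    _ ≤ n * Real.exp (-(γ + 1) * Real.log n) := by
        rw [nsmul_eq_mul]; gcongr
    _ = (n : ℝ) ^ (-γ) := by
        rw [Real.rpow_def_of_pos hn0]
        nth_rewrite 1 [← Real.exp_log hn0]
        rw [← Real.exp_add]
        ring_nf

end ChangePoint

theorem theorem1 (γ : ℝ) (hγ : 0 < γ) (ε : ℝ) (hε : 0 < ε) (hε' : ε < 1 / 2) :
    ∃ κ c : ℝ, 0 < κ ∧ 0 < c ∧
      ∀ (n d T : ℕ) (s L σ τ : ℝ) (θm θp : EuclideanSpace ℝ (Fin d))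
        {Ω : Type*} [MeasurableSpace Ω] (P : Measure Ω) [IsProbabilityMeasure P]
        (Y : Fin n → Ω → EuclideanSpace ℝ (Fin d)) (kHat : Ω → ℕ),
        1 ≤ T → T ≤ d → 0 < s → 0 < σ →
        ε < τ → τ < 1 - ε →
        2 ≤ ⌊(n : ℝ) * τ⌋₊ → ⌊(n : ℝ) * τ⌋₊ + 2 ≤ n →
        θm ∈ ChangePoint.sobolevClass d s L → θp ∈ ChangePoint.sobolevClass d s L →
        ChangePoint.IsModel P σ τ θm θp Y → ChangePoint.IsEstimator T Y kHat →
        (max (2 * c * (σ ^ 2 * Real.log n / n)) (8 * L ^ 2 * (T : ℝ) ^ (-2 * s))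
            ≤ ‖θp - θm‖ ^ 2 →
          P.real {ω | κ * Real.log n * ChangePoint.rate σ n T ‖θp - θm‖
              ≤ |(kHat ω : ℝ) / n - (⌊(n : ℝ) * τ⌋₊ : ℝ) / n|} ≤ (n : ℝ) ^ (-γ)) ∧
        (max (max (2 * c * (σ ^ 2 * Real.log n / n)) (8 * L ^ 2 * (T : ℝ) ^ (-2 * s)))
            (σ ^ 2 * T / n) ≤ ‖θp - θm‖ ^ 2 →
          P.real {ω | κ * (σ ^ 2 * Real.log n / (n * ‖θp - θm‖ ^ 2))
              ≤ |(kHat ω : ℝ) / n - (⌊(n : ℝ) * τ⌋₊ : ℝ) / n|} ≤ (n : ℝ) ^ (-γ)) := by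
  -- Any `c > 0` serves: the lower bound in `ln n` enters through `Δ > 0`. In `κ`, the factor `48`
  -- comes from `δ`, and `12 = 3 * 4` from `M ≥ ε² n Δ² / 3` and the remaining drift `M / (4 σ²)`.
  refine ⟨576 * (γ + 1) / ε ^ 4, 1, by positivity, one_pos, ?_⟩
  intro n d T s L σ τ θm θp Ω _ P _ Y kHat hT _ _ hσ hτ hτ' hm2 hmn2 hm hp hY hk
  have hn4 : (4 : ℝ) ≤ n := by exact_mod_cast (by omega : 4 ≤ n)
  have hn0 : (0 : ℝ) < n := by linarith
  have hlog : 0 < Real.log n := Real.log_pos (by linarith)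
  have hpos : 2 * 1 * (σ ^ 2 * Real.log n / n) ≤ ‖θp - θm‖ ^ 2 → 0 < ‖θp - θm‖ := by
    intro h
    have h1 : 0 < ‖θp - θm‖ ^ 2 := lt_of_lt_of_le (by positivity) h
    exact (norm_nonneg _).lt_of_ne' fun h0 ↦ by rw [h0] at h1; norm_num at h1
  have main : max (2 * 1 * (σ ^ 2 * Real.log n / n)) (8 * L ^ 2 * (T : ℝ) ^ (-2 * s))
      ≤ ‖θp - θm‖ ^ 2 → _ := fun h ↦
    ChangePoint.measureReal_error_le hγ hε hε' hT hσ hτ hτ' hm2 hmn2 hm hp hY hk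
      (hpos ((le_max_left _ _).trans h)) ((le_max_right _ _).trans h)
  refine ⟨main, fun h ↦ ?_⟩
  -- When `σ² T / n ≤ Δ²`, the maximum in `Ψ_n(T, Δ)` is `1`, and the claim is the previous one.
  have h12 := (le_max_left _ _).trans h
  have h3 := (le_max_right _ _).trans h
  have hΔ := hpos ((le_max_left _ _).trans h12)
  have hrate : 576 * (γ + 1) / ε ^ 4 * Real.log n * ChangePoint.rate σ n T ‖θp - θm‖ =
      576 * (γ + 1) / ε ^ 4 * (σ ^ 2 * Real.log n / (n * ‖θp - θm‖ ^ 2)) := by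
    have h4 : σ ^ 2 * (T : ℝ) / (n * ‖θp - θm‖ ^ 2) ≤ 1 := by
      rw [div_le_iff₀ hn0] at h3
      rw [div_le_one (by positivity)]
      linarith
    rw [ChangePoint.rate, max_eq_left h4]
    ring
  rw [← hrate]
  exact main h12
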